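/- Let $R$ be an associative ring with unit that is left and right coherent (every finitely generated left ideal and every finitely generated right ideal is finitely presented). The following conditions are equivalent: 1. $R$ is weakly quasi-Frobenius (a WQF-ring), i.e. the functors $\operatorname{Hom}_R(-,R)$ restrict to a duality between the categories of finitely presented left $R$-modules and finitely presented right $R$-modules: they take finitely presented modules to finitely presented modules, and on these categories both composites are naturally isomorphic to the identity functors; 2. the modules ${}_RR$ and $R_R$ are FP-injective; 3. the modules ${}_RR$ and $R_R$ are FP-cogenerators; 4. the module $R_R$ is an FP-injective FP-cogenerator; 5. every finitely presented left $R$-module and every finitely presented right $R$-module is reflexive; 6. every cyclic finitely presented left $R$-module and every cyclic finitely presented right $R$-module is reflexive; 7. every cyclic finitely presented left $R$-module and every cyclic finitely presented right $R$-module embeds in a free module; 8. for every finitely generated left ideal $I$ and every finitely generated right ideal $J$ of $R$ one has $\mathfrak l(\mathfrak r(I))=I$ and $\mathfrak r(\mathfrak l(J))=J$, where $\mathfrak l(X)=\{r\in R\mid rx=0\ \text{for all } x\in X\}$ and $\mathfrak r(X)=\{r\in R\mid xr=0\ \text{for all } x\in X\}$. Here a left (right) $R$-module $K$ is FP-injective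 if $\operatorname{Ext}^1_R(F,K)=0$ for every finitely presented left (right) module $F$; it is an FP-cogenerator if for every non-zero homomorphism $f:M\to N$ of left (right) modules with $M$ finitely generated and $N$ finitely presented there is a homomorphism $g:N\to K$ with $gf\neq 0$. With $M^*=\operatorname{Hom}_R(M,R)$, a module $M$ is reflexive if the canonical homomorphism $M\to M^{**}$ is an isomorphism. -/

import Mathlib

open CategoryTheory

universe u

namespace WeaklyQF

/-! Left `R`-modules are `Module R M`, right `R`-modules are `Module Rᵐᵒᵖ M`. In particular
`R` over `R` is the left regular module, `R` over `Rᵐᵒᵖ` the right regular module; left ideals are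
`Submodule R R`, right ideals are `Submodule Rᵐᵒᵖ R`. The notions below are given for modules over
an arbitrary ring `A`, and duals with respect to a bimodule `U` with commuting actions of two
rings `A` and `B`; for `U = R`, `(A, B)` is `(R, Rᵐᵒᵖ)` or `(Rᵐᵒᵖ, R)`. -/

section OneRing

variable (A : Type u) [Ring A]

/-- Finitely generated, and every finitely generated submodule is finitely presented. `R` is left
coherent when this holds for `R` over `R`, right coherent when it holds for `R` over `Rᵐᵒᵖ`. -/
def IsCoherentModule (M : Type u) [AddCommGroup M] [Module A M] : Prop :=
  Module.Finite A M ∧ ∀ N : Submodule A M, N.FG → Module.FinitePresentation A N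

/-- `Ext¹(F, K) = 0` for every finitely presented module `F`. -/
def IsFPInjective (K : Type u) [AddCommGroup K] [Module A K] : Prop :=
  ∀ (F : Type u) [AddCommGroup F] [Module A F], Module.FinitePresentation A F →
    Subsingleton (Abelian.Ext (ModuleCat.of A F) (ModuleCat.of A K) 1)

/-- For every nonzero `f : M → N` with `M` finitely generated and `N` finitely presented there is
`g : N → K` with `g ∘ f ≠ 0`. -/
def IsFPCogenerator (K : Type u) [AddCommGroup K] [Module A K] : Prop :=
  ∀ (M N : Type u) [AddCommGroup M] [Module A M] [AddCommGroup N] [Module A N],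
    Module.Finite A M → Module.FinitePresentation A N →
      ∀ f : M →ₗ[A] N, f ≠ 0 → ∃ g : N →ₗ[A] K, g ∘ₗ f ≠ 0

/-- Generated by one element. -/
def IsCyclicModule (M : Type u) [AddCommGroup M] [Module A M] : Prop :=
  ∃ x : M, Submodule.span A {x} = ⊤

/-- There is an injective linear map into a free module. -/
def EmbedsInFree (M : Type u) [AddCommGroup M] [Module A M] : Prop :=
  ∃ (F : Type u) (_ : AddCommGroup F) (_ : Module A F) (_ : Module.Free A F) (f : M →ₗ[A] F),
    Function.Injective f

/-- The property of being finitely presented, on the category of `A`-modules. -/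
def fpModules : ObjectProperty (ModuleCat.{u} A) :=
  fun M => Module.FinitePresentation A M

end OneRing

section Duality

variable (A B U : Type u) [Ring A] [Ring B] [AddCommGroup U] [Module A U] [Module B U]
  [SMulCommClass A B U] [SMulCommClass B A U]

/-- The canonical map `M → M**`, `x ↦ (φ ↦ φ x)`, where `M* = Hom_A(M, U)` is a `B`-module through
the action of `B` on `U`, and `M** = Hom_B(M*, U)`. -/
def evalBidual (M : Type u) [AddCommGroup M] [Module A M] :
    M →ₗ[A] ((M →ₗ[A] U) →ₗ[B] U) where
  toFun x :=
    { toFun := fun φ => φ x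
      map_add' := fun _ _ => rfl
      map_smul' := fun _ _ => rfl }
  map_add' x y := by ext φ; exact map_add φ x y
  map_smul' a x := by ext φ; exact map_smul φ a x

/-- The canonical map `M → M**` is an isomorphism. -/
def IsReflexiveModule (M : Type u) [AddCommGroup M] [Module A M] : Prop :=
  Function.Bijective (evalBidual A B U M)

/-- The contravariant functor `Hom_A(-, U)` from `A`-modules to `B`-modules. -/
def dualFunctor : (ModuleCat.{u} A)ᵒᵖ ⥤ ModuleCat.{u} B where
  obj M := ModuleCat.of B (M.unop →ₗ[A] U)
  map f := ModuleCat.ofHom (LinearMap.lcomp B U f.unop.hom)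
  map_id _ := rfl
  map_comp _ _ := rfl

/-- `Hom_A(-, U)` takes finitely presented `A`-modules to finitely presented `B`-modules. -/
def DualPreservesFP : Prop :=
  ∀ M : ModuleCat.{u} A, fpModules A M → fpModules B ((dualFunctor A B U).obj (Opposite.op M))

/-- The functor `Hom_A(-, U)` between the full subcategories of finitely presented modules. -/
def fpDualFunctor (h : DualPreservesFP A B U) :
    (fpModules A).FullSubcategoryᵒᵖ ⥤ (fpModules B).FullSubcategory :=
  (fpModules B).lift ((fpModules A).ι.op ⋙ dualFunctor A B U)
    (fun M => h M.unop.obj M.unop.property)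

/-- The functors `Hom_A(-, U)` and `Hom_B(-, U)` restrict to the categories of finitely presented
modules and there form a duality: both composites are naturally isomorphic to the identity. -/
def DeterminesFPDuality : Prop :=
  ∃ (hA : DualPreservesFP A B U) (hB : DualPreservesFP B A U),
    Nonempty (𝟭 _ ≅ (fpDualFunctor A B U hA).rightOp ⋙ fpDualFunctor B A U hB) ∧
    Nonempty (𝟭 _ ≅ (fpDualFunctor B A U hB).rightOp ⋙ fpDualFunctor A B U hA)

end Duality

section Regular

variable (R : Type u) [Ring R]

/-- A weakly quasi-Frobenius ring: the bimodule `R` determines a duality between the categories of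
finitely presented left and right `R`-modules. -/
def IsWQF : Prop := DeterminesFPDuality R Rᵐᵒᵖ R

variable {R}

/-- `l(X) = {r | r x = 0 for all x ∈ X}`, a left ideal. -/
def leftAnn (X : Set R) : Submodule R R where
  carrier := {r | ∀ x ∈ X, r * x = 0}
  zero_mem' := fun x _ => zero_mul x
  add_mem' := fun ha hb x hx => by rw [add_mul, ha x hx, hb x hx, add_zero]
  smul_mem' := fun c r hr x hx => by rw [smul_eq_mul, mul_assoc, hr x hx, mul_zero]

/-- `r(X) = {r | x r = 0 for all x ∈ X}`, a right ideal. -/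
def rightAnn (X : Set R) : Submodule Rᵐᵒᵖ R where
  carrier := {r | ∀ x ∈ X, x * r = 0}
  zero_mem' := fun x _ => mul_zero x
  add_mem' := fun ha hb x hx => by rw [mul_add, ha x hx, hb x hx, add_zero]
  smul_mem' := fun c r hr x hx => by
    rw [MulOpposite.smul_eq_mul_unop, ← mul_assoc, hr x hx, zero_mul]

end Regular

end WeaklyQF

/-! Call a module torsionless when maps to `R` separate its points. Left and right linear
endomorphisms of `R` are multiplications, so `l(r(I)) = I` says that `R/I` is torsionless; thus (8)
says that cyclic finitely presented modules on both sides are torsionless. Conditions (3), (4), (7)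
give this directly, (1) through (3) and (6) through (7).

The hard step is (8) ⇒ (2), an Ikeda–Nakayama argument (`IsBiregular.extendsFromFG`): maps from
finitely generated ideals to `R` extend to `R`, by induction on generators. Coherence keeps
annihilators of finitely generated ideals finitely generated and carries the extension property to
`R^n`, whence `Ext¹` vanishes.

For (2) ⇒ (5) (`IsBiregular.isReflexiveModule`), a finite presentation is dualised twice;
FP-injectivity on the opposite side makes the second dual exact. Evaluation then gives the duality
(1).

One-sided arguments use a bimodule `U` with a common free generator over `A` and `B`, so exchanging
`A` and `B` gives the other side. -/

namespace WeaklyQF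

/-! ### Finite powers of coherent modules -/

section Coherent

variable {A : Type u} [Ring A] {M M' : Type u} [AddCommGroup M] [Module A M]
  [AddCommGroup M'] [Module A M']

theorem IsCoherentModule.of_linearEquiv (h : IsCoherentModule A M) (e : M ≃ₗ[A] M') :
    IsCoherentModule A M' := by
  have := h.1
  refine ⟨Module.Finite.equiv e, fun N hN => ?_⟩
  have := h.2 (N.map e.symm.toLinearMap) (hN.map _)
  exact .of_equiv (e.symm.submoduleMap N).symm

/-- A finitely generated `N` is an extension of its image in `M'` by a submodule of `M`. The image
is finitely presented, so the kernel is finitely generated, hence finitely presented too. -/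
theorem IsCoherentModule.prod (h : IsCoherentModule A M) (h' : IsCoherentModule A M') :
    IsCoherentModule A (M × M') := by
  have := h.1
  have := h'.1
  refine ⟨inferInstance, fun N hN => ?_⟩
  have : Module.Finite A N := .of_fg hN
  let f : N →ₗ[A] M' := LinearMap.snd A M M' ∘ₗ N.subtype
  have : Module.FinitePresentation A (LinearMap.range f) := h'.2 _ (Submodule.fg_range f)
  have hker : (LinearMap.ker f).FG := by
    rw [← LinearMap.ker_rangeRestrict]
    exact Module.FinitePresentation.fg_ker _ f.surjective_rangeRestrict
  let g : LinearMap.ker f →ₗ[A] M := LinearMap.fst A M M' ∘ₗ N.subtype ∘ₗ (LinearMap.ker f).subtype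
  have hg : Function.Injective g := by
    rintro ⟨⟨x, hx⟩, hx'⟩ ⟨⟨y, hy⟩, hy'⟩ hxy
    have h1 : x.2 = 0 := hx'
    have h2 : y.2 = 0 := hy'
    have h3 : x.1 = y.1 := hxy
    simp only [Subtype.mk.injEq]
    exact Prod.ext h3 (h1.trans h2.symm)
  have : Module.Finite A (LinearMap.ker f) := .of_fg hker
  have := h.2 _ (Submodule.fg_range g)
  have hfp : Module.FinitePresentation A (LinearMap.ker f) :=
    (LinearEquiv.finitePresentation_iff (M := LinearMap.ker f)
      (LinearEquiv.ofInjective g hg)).mpr this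
  rw [← LinearMap.ker_rangeRestrict] at hfp
  exact Module.finitePresentation_of_ker f.rangeRestrict f.surjective_rangeRestrict

theorem IsCoherentModule.pi (h : IsCoherentModule A M) :
    ∀ n : ℕ, IsCoherentModule A (Fin n → M)
  | 0 => ⟨inferInstance, fun _ _ => inferInstance⟩
  | n + 1 => (h.prod (h.pi n)).of_linearEquiv (Fin.consLinearEquiv A fun _ => M)

end Coherent

/-! ### Extension of homomorphisms and FP-injectivity -/

section Extension

/-- Every homomorphism from a finitely generated submodule of `M` to `U` extends to `M`. -/
def ExtendsFromFG (A U M : Type u) [Ring A] [AddCommGroup U] [Module A U] [AddCommGroup M]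
    [Module A M] : Prop :=
  ∀ N : Submodule A M, N.FG → ∀ f : N →ₗ[A] U, ∃ g : M →ₗ[A] U, ∀ x : N, g x = f x

variable {A : Type u} [Ring A] {U M M' : Type u} [AddCommGroup U] [Module A U] [AddCommGroup M]
  [Module A M] [AddCommGroup M'] [Module A M']

theorem ExtendsFromFG.of_linearEquiv (h : ExtendsFromFG A U M) (e : M ≃ₗ[A] M') :
    ExtendsFromFG A U M' := by
  intro N hN f
  obtain ⟨g, hg⟩ := h (N.map e.symm.toLinearMap) (hN.map _)
    (f ∘ₗ (e.symm.submoduleMap N).symm.toLinearMap)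
  refine ⟨g ∘ₗ e.symm.toLinearMap, fun x => ?_⟩
  have := hg (e.symm.submoduleMap N x)
  simpa using this

/-- A homomorphism `L → U` vanishing on the kernel of `h : L → M`, with `L` finitely generated,
factors through `h`. -/
theorem ExtendsFromFG.exists_comp_eq (hM : ExtendsFromFG A U M) {L : Type u} [AddCommGroup L]
    [Module A L] [Module.Finite A L] (h : L →ₗ[A] M) (φ : L →ₗ[A] U)
    (hφ : LinearMap.ker h ≤ LinearMap.ker φ) : ∃ ψ : M →ₗ[A] U, ψ ∘ₗ h = φ := by
  obtain ⟨ψ, hψ⟩ := hM (LinearMap.range h) (Submodule.fg_range h)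
    ((LinearMap.ker h).liftQ φ hφ ∘ₗ h.quotKerEquivRange.symm.toLinearMap)
  refine ⟨ψ, LinearMap.ext fun x => ?_⟩
  have := hψ ⟨h x, x, rfl⟩
  rw [LinearMap.comp_apply, this, LinearMap.comp_apply]
  have hx : h.quotKerEquivRange.symm ⟨h x, x, rfl⟩ = Submodule.Quotient.mk x := by
    rw [LinearEquiv.symm_apply_eq]; rfl
  erw [hx]
  rfl

/-- Extend `f` from `N ∩ M` to `M` and subtract; the remainder factors through the projection to
`M'`. Coherence of `M'` makes `N ∩ M` finitely generated. -/
theorem ExtendsFromFG.prod (h : ExtendsFromFG A U M) (h' : ExtendsFromFG A U M')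
    (hc : IsCoherentModule A M') : ExtendsFromFG A U (M × M') := by
  intro N hN f
  have : Module.Finite A N := .of_fg hN
  let p : N →ₗ[A] M' := LinearMap.snd A M M' ∘ₗ N.subtype
  have : Module.FinitePresentation A (LinearMap.range p) := hc.2 _ (Submodule.fg_range p)
  have hker : (LinearMap.ker p).FG := by
    rw [← LinearMap.ker_rangeRestrict]
    exact Module.FinitePresentation.fg_ker _ p.surjective_rangeRestrict
  have : Module.Finite A (LinearMap.ker p) := .of_fg hker
  obtain ⟨g, hg⟩ := h.exists_comp_eq (L := LinearMap.ker p)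
    (LinearMap.fst A M M' ∘ₗ N.subtype ∘ₗ (LinearMap.ker p).subtype)
    (f ∘ₗ (LinearMap.ker p).subtype) (by
      intro x hx
      have h1 : (x : M × M').2 = 0 := x.2
      have h2 : (x : M × M').1 = 0 := hx
      have h3 : (x : N) = 0 := Subtype.ext (Prod.ext h2 h1)
      change f x = 0
      rw [h3, map_zero])
  obtain ⟨g', hg'⟩ := h'.exists_comp_eq p (f - g ∘ₗ LinearMap.fst A M M' ∘ₗ N.subtype) (by
      intro x hx
      have := LinearMap.congr_fun hg ⟨x, hx⟩
      exact sub_eq_zero.mpr this.symm)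
  refine ⟨g.coprod g', fun x => ?_⟩
  have : g' (x : M × M').2 = f x - g (x : M × M').1 := LinearMap.congr_fun hg' x
  rw [LinearMap.coprod_apply, this, add_sub_cancel]

theorem ExtendsFromFG.pi (h : ExtendsFromFG A U M) (hc : IsCoherentModule A M) :
    ∀ n : ℕ, ExtendsFromFG A U (Fin n → M)
  | 0 => fun _ _ _ => ⟨0, fun x => by rw [Subsingleton.elim x 0]; simp⟩
  | n + 1 => (h.prod (h.pi hc n) (hc.pi n)).of_linearEquiv (Fin.consLinearEquiv A fun _ => M)

/-- The short exact sequence `0 → N → M → M/N → 0`. -/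
theorem shortExact_quotient (N : Submodule A M) :
    (ShortComplex.mk (ModuleCat.ofHom N.subtype) (ModuleCat.ofHom N.mkQ)
      (by ext x; simp)).ShortExact where
  exact := (ShortComplex.ShortExact.moduleCat_exact_iff_function_exact _).mpr
    (LinearMap.exact_subtype_mkQ N)
  mono_f := (ModuleCat.mono_iff_injective _).mpr N.injective_subtype
  epi_g := (ModuleCat.epi_iff_surjective _).mpr N.mkQ_surjective

theorem IsFPInjective.extendsFromFG (h : IsFPInjective A U) (hM : Module.FinitePresentation A M) :
    ExtendsFromFG A U M := by
  intro N hN f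
  have hfp : Module.FinitePresentation A (M ⧸ N) :=
    Module.finitePresentation_of_surjective N.mkQ N.mkQ_surjective (by rwa [Submodule.ker_mkQ])
  have := h (M ⧸ N) hfp
  obtain ⟨y, hy⟩ := Abelian.Ext.contravariant_sequence_exact₁ (shortExact_quotient N)
    (ModuleCat.of A U) (Abelian.Ext.mk₀ (ModuleCat.ofHom f)) (n₁ := 1) rfl
    (Subsingleton.elim (α := Abelian.Ext (ModuleCat.of A (M ⧸ N)) (ModuleCat.of A U) 1) _ _)
  obtain ⟨g, rfl⟩ := Abelian.Ext.addEquiv₀.symm.surjective y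
  refine ⟨g.hom, fun x => ?_⟩
  have : ModuleCat.ofHom N.subtype ≫ g = ModuleCat.ofHom f := by
    apply Abelian.Ext.mk₀_bijective _ _ |>.1
    rw [← hy, ← Abelian.Ext.mk₀_comp_mk₀]
    rfl
  exact LinearMap.congr_fun (ModuleCat.hom_ext_iff.mp this) x

/-- Write `F = A^n/K`. As `A^n` is projective, each class in `Ext¹(F, U)` is the connecting image of
a map `K → U`, and it vanishes once that map extends to `A^n`. -/
theorem isFPInjective_of_extendsFromFG_pi (h : ∀ n : ℕ, ExtendsFromFG A U (Fin n → A)) :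
    IsFPInjective A U := by
  intro F _ _ hF
  obtain ⟨n, K, e, hK⟩ := Module.FinitePresentation.exists_fin A F
  have hS := shortExact_quotient K
  suffices H : ∀ x : Abelian.Ext (ModuleCat.of A ((Fin n → A) ⧸ K)) (ModuleCat.of A U) 1, x = 0 by
    refine ⟨fun x y => ?_⟩
    suffices H' : ∀ x : Abelian.Ext (ModuleCat.of A F) (ModuleCat.of A U) 1, x = 0 by
      rw [H' x, H' y]
    intro x
    have h1 := H ((Abelian.Ext.mk₀ e.toModuleIso.inv).comp x (zero_add 1))
    have h2 := congrArg (fun z => (Abelian.Ext.mk₀ e.toModuleIso.hom).comp z (zero_add 1)) h1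
    rwa [Abelian.Ext.mk₀_comp_mk₀_assoc, e.toModuleIso.hom_inv_id, Abelian.Ext.mk₀_id_comp,
      Abelian.Ext.comp_zero] at h2
  intro x
  have : Projective (ModuleCat.of A (Fin n → A)) :=
    (IsProjective.iff_projective (Fin n → A)).mp inferInstance
  obtain ⟨y, rfl⟩ := Abelian.Ext.contravariant_sequence_exact₃ hS (ModuleCat.of A U) x
    (Abelian.Ext.eq_zero_of_projective _) (n₀ := 0) rfl
  obtain ⟨f, rfl⟩ := Abelian.Ext.addEquiv₀.symm.surjective y
  obtain ⟨g, hg⟩ := h n K hK f.hom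
  have hfg : f = ModuleCat.ofHom K.subtype ≫ ModuleCat.ofHom g := by
    ext x
    exact (hg x).symm
  have h0 := hS.extClass_comp_assoc (Y := ModuleCat.of A U) (Abelian.Ext.mk₀ (ModuleCat.ofHom g))
    (n' := 1) (h := rfl)
  rw [hfg]
  rw [Abelian.Ext.mk₀_comp_mk₀] at h0
  exact h0

end Extension

/-! ### Torsionless modules -/

/-- Some element of `U` is a free generator of `U` both over `A` and over `B`. -/
def IsBiregular (A B U : Type u) [Ring A] [Ring B] [AddCommGroup U] [Module A U]
    [Module B U] : Prop :=
  ∃ u : U, Function.Bijective (fun a : A => a • u) ∧ Function.Bijective (fun b : B => b • u)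

/-- Homomorphisms to `U` separate the points of `M`. -/
def IsTorsionless (A U M : Type u) [Ring A] [AddCommGroup U] [Module A U] [AddCommGroup M]
    [Module A M] : Prop :=
  ∀ x : M, (∀ φ : M →ₗ[A] U, φ x = 0) → x = 0

section Torsionless

variable {A U M M' : Type u} [Ring A] [AddCommGroup U] [Module A U] [AddCommGroup M]
  [Module A M] [AddCommGroup M'] [Module A M']

theorem IsTorsionless.of_injective (h : IsTorsionless A U M') (f : M →ₗ[A] M')
    (hf : Function.Injective f) : IsTorsionless A U M := fun x hx =>
  hf (by rw [map_zero]; exact h _ fun φ => hx (φ ∘ₗ f))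

theorem isTorsionless_quotient_iff {N : Submodule A M} : IsTorsionless A U (M ⧸ N) ↔
    ∀ x : M, (∀ φ : M →ₗ[A] U, N ≤ LinearMap.ker φ → φ x = 0) → x ∈ N := by
  constructor
  · intro h x hx
    rw [← Submodule.Quotient.mk_eq_zero]
    refine h _ fun φ => hx (φ ∘ₗ N.mkQ) fun y hy => ?_
    rw [LinearMap.mem_ker, LinearMap.comp_apply, Submodule.mkQ_apply,
      (Submodule.Quotient.mk_eq_zero N).mpr hy, map_zero]
  · intro h x hx
    obtain ⟨y, rfl⟩ := N.mkQ_surjective x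
    exact (Submodule.Quotient.mk_eq_zero N).mpr (h y fun φ hφ => hx (N.liftQ φ hφ))

/-- It suffices to test inclusions of cyclic submodules `A x` into `N`. -/
theorem isFPCogenerator_iff : IsFPCogenerator A U ↔
    ∀ (M : Type u) [AddCommGroup M] [Module A M], Module.FinitePresentation A M →
      IsTorsionless A U M := by
  constructor
  · intro h M _ _ hM x hx
    by_contra hne
    obtain ⟨g, hg⟩ := h (Submodule.span A {x}) M
      (.of_fg (Submodule.fg_span_singleton x)) hM (Submodule.span A {x}).subtype
      fun h0 => hne (LinearMap.congr_fun h0 ⟨x, Submodule.mem_span_singleton_self x⟩)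
    refine hg (LinearMap.ext fun y => ?_)
    obtain ⟨a, ha⟩ := Submodule.mem_span_singleton.mp y.2
    change g y = 0
    rw [← ha, map_smul, hx, smul_zero]
  · intro h M N _ _ _ _ _ hN f hf
    by_contra! hg
    refine hf (LinearMap.ext fun x => h N hN _ fun φ => ?_)
    exact LinearMap.congr_fun (hg φ) x

end Torsionless

/-! ### Duals of finitely presented modules and reflexivity -/

section Dual

variable {A B U : Type u} [Ring A] [Ring B] [AddCommGroup U] [Module A U] [Module B U]
  {M : Type u} [AddCommGroup M] [Module A M]

theorem IsBiregular.symm (h : IsBiregular A B U) : IsBiregular B A U :=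
  h.imp fun _ hu => hu.symm

theorem IsBiregular.nonempty_linearEquiv (h : IsBiregular A B U) : Nonempty (A ≃ₗ[A] U) := by
  obtain ⟨u, hu, -⟩ := h
  exact ⟨LinearEquiv.ofBijective (LinearMap.toSpanSingleton A U u) hu⟩

theorem IsBiregular.finitePresentation (h : IsBiregular A B U) : Module.FinitePresentation A U :=
  h.nonempty_linearEquiv.elim fun e => .of_equiv e

theorem IsBiregular.isCyclicModule (h : IsBiregular A B U) : IsCyclicModule A U := by
  obtain ⟨u, hu, -⟩ := h
  refine ⟨u, eq_top_iff.mpr fun x _ => ?_⟩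
  obtain ⟨a, rfl⟩ := hu.2 x
  exact Submodule.smul_mem _ _ (Submodule.mem_span_singleton_self u)

theorem IsBiregular.exists_presentation (h : IsBiregular A B U)
    (hM : Module.FinitePresentation A M) :
    ∃ (n m : ℕ) (p : (Fin n → U) →ₗ[A] M) (d : (Fin m → U) →ₗ[A] (Fin n → U)),
      Function.Surjective p ∧ LinearMap.ker p = LinearMap.range d := by
  obtain ⟨e⟩ := h.nonempty_linearEquiv
  obtain ⟨n, m, p, d, hp, hd⟩ := Module.FinitePresentation.exists_fin' A M
  let en := LinearEquiv.piCongrRight (R := A) fun _ : Fin n => e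
  let em := LinearEquiv.piCongrRight (R := A) fun _ : Fin m => e
  refine ⟨n, m, p ∘ₗ en.symm.toLinearMap, en.toLinearMap ∘ₗ d ∘ₗ em.symm.toLinearMap,
    hp.comp en.symm.surjective, ?_⟩
  rw [LinearMap.ker_comp, LinearMap.exact_iff.mp hd, Submodule.comap_equiv_eq_map_symm,
    LinearEquiv.symm_symm, LinearMap.range_comp, LinearMap.range_comp_of_range_eq_top]
  exact LinearEquiv.range em.symm

theorem IsBiregular.isTorsionless_of_embedsInFree (hU : IsBiregular A B U)
    (h : EmbedsInFree A M) :
    IsTorsionless A U M := by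
  obtain ⟨F, _, _, _, f, hf⟩ := h
  obtain ⟨e⟩ := hU.nonempty_linearEquiv
  refine IsTorsionless.of_injective (fun x hx => ?_) f hf
  refine (Module.Free.chooseBasis A F).ext_elem fun i => e.injective ?_
  rw [map_zero, Finsupp.zero_apply, map_zero]
  exact hx (e.toLinearMap ∘ₗ (Module.Free.chooseBasis A F).coord i)

variable [SMulCommClass A B U]

theorem IsBiregular.nonempty_dual_pi (h : IsBiregular A B U) (n : ℕ) :
    Nonempty (((Fin n → U) →ₗ[A] U) ≃ₗ[B] (Fin n → U)) := by
  obtain ⟨u, hA, hB⟩ := h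
  let F : ((Fin n → U) →ₗ[A] U) →ₗ[B] (Fin n → U) :=
    { toFun := fun f i => f (Pi.single i u)
      map_add' := fun _ _ => rfl
      map_smul' := fun _ _ => rfl }
  refine ⟨LinearEquiv.ofBijective F ⟨fun f g hfg => ?_, fun w => ?_⟩⟩
  · refine LinearMap.pi_ext fun i x => ?_
    obtain ⟨a, rfl⟩ := hA.2 x
    have : f (Pi.single i u) = g (Pi.single i u) := congrFun hfg i
    simp only [Pi.single_smul, map_smul, this]
  · choose b hb using fun i => hB.2 (w i)
    refine ⟨∑ i, b i • LinearMap.proj i, funext fun j => ?_⟩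
    change (∑ i, b i • LinearMap.proj i : (Fin n → U) →ₗ[A] U) (Pi.single j u) = w j
    rw [← hb j, LinearMap.sum_apply, Finset.sum_eq_single j]
    · simp
    · intro i _ hij
      simp [Pi.single_eq_of_ne hij]
    · simp

/-- Dualising `U^m → U^n → M → 0` exhibits `M*` as the kernel of a map between coherent modules. -/
theorem IsBiregular.finitePresentation_dual (hU : IsBiregular A B U)
    (hB : IsCoherentModule B U) (hM : Module.FinitePresentation A M) :
    Module.FinitePresentation B (M →ₗ[A] U) := by
  obtain ⟨n, m, p, d, hp, hd⟩ := hU.exists_presentation hM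
  obtain ⟨en⟩ := hU.nonempty_dual_pi n
  obtain ⟨em⟩ := hU.nonempty_dual_pi m
  have cn := (hB.pi n).of_linearEquiv en.symm
  have cm := (hB.pi m).of_linearEquiv em.symm
  have := cn.1
  let D := LinearMap.lcomp B U d
  let P := LinearMap.lcomp B U p
  have hP : Function.Injective P := fun f g hfg =>
    LinearMap.ext fun x => by
      obtain ⟨y, rfl⟩ := hp x
      exact LinearMap.congr_fun hfg y
  have hPD : LinearMap.range P = LinearMap.ker D := by
    ext f
    constructor
    · rintro ⟨g, rfl⟩
      refine LinearMap.ext fun y => ?_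
      have : d y ∈ LinearMap.ker p := hd ▸ LinearMap.mem_range_self d y
      change g (p (d y)) = 0
      rw [this, map_zero]
    · intro hf
      have hf' : LinearMap.ker p ≤ LinearMap.ker f := by
        rw [hd]
        rintro _ ⟨y, rfl⟩
        exact LinearMap.congr_fun hf y
      refine ⟨(LinearMap.ker p).liftQ f hf' ∘ₗ
        (p.quotKerEquivOfSurjective hp).symm.toLinearMap, LinearMap.ext fun y => ?_⟩
      have hy : (p.quotKerEquivOfSurjective hp).symm (p y) = Submodule.Quotient.mk y := by
        rw [LinearEquiv.symm_apply_eq]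
        rfl
      change (LinearMap.ker p).liftQ f hf' ((p.quotKerEquivOfSurjective hp).symm (p y)) = f y
      rw [hy]
      rfl
  have : Module.FinitePresentation B (LinearMap.range D) := cm.2 _ (Submodule.fg_range D)
  have hker : (LinearMap.ker D).FG := by
    rw [← LinearMap.ker_rangeRestrict]
    exact Module.FinitePresentation.fg_ker _ D.surjective_rangeRestrict
  exact (LinearEquiv.finitePresentation_iff (LinearEquiv.ofInjective P hP)).mpr
    (cn.2 _ (hPD ▸ hker))

variable [SMulCommClass B A U]

theorem isTorsionless_iff : IsTorsionless A U M ↔ Function.Injective (evalBidual A B U M) := by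
  rw [← LinearMap.ker_eq_bot, LinearMap.ker_eq_bot']
  exact forall_congr' fun x => imp_congr_left
    ⟨fun h => LinearMap.ext h, LinearMap.congr_fun⟩

theorem isTorsionless_dual (N : Type u) [AddCommGroup N] [Module B N] :
    IsTorsionless A U (N →ₗ[B] U) := fun _ hφ =>
  LinearMap.ext fun x => hφ (evalBidual B A U N x)

theorem IsReflexiveModule.exists_eq_eval (h : IsReflexiveModule A B U M)
    (φ : (M →ₗ[A] U) →ₗ[B] U) : ∃ x : M, ∀ f : M →ₗ[A] U, φ f = f x := by
  obtain ⟨x, rfl⟩ := h.2 φ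
  exact ⟨x, fun _ => rfl⟩

theorem IsBiregular.isReflexiveModule_pi (h : IsBiregular A B U) (n : ℕ) :
    IsReflexiveModule A B U (Fin n → U) := by
  refine ⟨isTorsionless_iff.mp fun x hx => funext fun i => hx (LinearMap.proj i), fun φ => ?_⟩
  obtain ⟨u, hA, hB⟩ := h
  refine ⟨fun i => φ (LinearMap.proj i), LinearMap.ext fun f => ?_⟩
  choose b hb using fun i => hB.2 (f (Pi.single i u))
  have hf : f = ∑ i, b i • LinearMap.proj i := by
    refine LinearMap.pi_ext fun i x => ?_
    obtain ⟨a, rfl⟩ := hA.2 x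
    rw [Pi.single_smul, map_smul, map_smul, ← hb i, LinearMap.sum_apply, Finset.sum_eq_single i]
    · simp
    · intro j _ hij
      simp [Pi.single_eq_of_ne hij]
    · simp
  change f _ = φ f
  conv_rhs => rw [hf]
  conv_lhs => rw [hf]
  simp [LinearMap.sum_apply]

theorem IsBiregular.isReflexiveModule_self (h : IsBiregular A B U) :
    IsReflexiveModule A B U U := by
  obtain ⟨u, hA, hB⟩ := h
  refine ⟨isTorsionless_iff.mp fun x hx => hx LinearMap.id, fun φ => ?_⟩
  refine ⟨φ LinearMap.id, LinearMap.ext fun f => ?_⟩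
  obtain ⟨b, hb⟩ := hB.2 (f u)
  have hf : f = b • LinearMap.id := by
    refine LinearMap.ext fun x => ?_
    obtain ⟨a, rfl⟩ := hA.2 x
    change f (a • u) = b • a • u
    rw [map_smul, ← hb, smul_comm]
  change f _ = φ f
  rw [hf, map_smul]
  rfl

/-- With `U^m → U^n → M → 0` given by `d` and `p`, FP-injectivity over `B` extends functionals along
`d*` and `p*`, and functionals on `(U^k)*` are evaluations. If all of `M*` kills `p y`, evaluation
at `y` factors through `d*`, so `y = d z` and `p y = 0`. A functional on `M*` extends along the
injection `p*` to evaluation at some `y`, so it is evaluation at `p y`. -/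
theorem IsBiregular.isReflexiveModule (hU : IsBiregular A B U)
    (hB : IsCoherentModule B U) (hE : IsFPInjective B U)
    (hM : Module.FinitePresentation A M) : IsReflexiveModule A B U M := by
  obtain ⟨n, m, p, d, hp, hd⟩ := hU.exists_presentation hM
  have hfp (k : ℕ) : Module.FinitePresentation B ((Fin k → U) →ₗ[A] U) := by
    have := hU.finitePresentation
    exact hU.finitePresentation_dual hB inferInstance
  have := hU.finitePresentation_dual hB hM
  have := hfp n
  refine ⟨isTorsionless_iff.mp fun x hx => ?_, fun φ => ?_⟩
  · obtain ⟨y, rfl⟩ := hp x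
    obtain ⟨ψ, hψ⟩ := (hE.extendsFromFG (hfp m)).exists_comp_eq (LinearMap.lcomp B U d)
      (evalBidual A B U _ y) (by
        intro f hf
        have hf' : LinearMap.ker p ≤ LinearMap.ker f := by
          rw [hd]
          rintro _ ⟨z, rfl⟩
          exact LinearMap.congr_fun hf z
        have hy : (p.quotKerEquivOfSurjective hp).symm (p y) = Submodule.Quotient.mk y := by
          rw [LinearEquiv.symm_apply_eq]
          rfl
        have h1 : (LinearMap.ker p).liftQ f hf' ((p.quotKerEquivOfSurjective hp).symm (p y)) = 0 :=
          hx ((LinearMap.ker p).liftQ f hf' ∘ₗ (p.quotKerEquivOfSurjective hp).symm.toLinearMap)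
        rwa [hy] at h1)
    obtain ⟨z, hz⟩ := (hU.isReflexiveModule_pi m).exists_eq_eval ψ
    have hyz : y = d z := funext fun i => by
      have h1 : ψ (LinearMap.proj i ∘ₗ d) = y i := LinearMap.congr_fun hψ (LinearMap.proj i)
      rw [← h1, hz]
      rfl
    have : y ∈ LinearMap.ker p := hd ▸ hyz ▸ LinearMap.mem_range_self d z
    exact this
  · obtain ⟨ψ, hψ⟩ := (hE.extendsFromFG (hfp n)).exists_comp_eq (LinearMap.lcomp B U p) φ (by
      intro f hf
      have : f = 0 := LinearMap.ext fun x => by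
        obtain ⟨y, rfl⟩ := hp x
        exact LinearMap.congr_fun hf y
      rw [this]
      exact zero_mem _)
    obtain ⟨y, hy⟩ := (hU.isReflexiveModule_pi n).exists_eq_eval ψ
    refine ⟨p y, LinearMap.ext fun f => ?_⟩
    have h1 : ψ (f ∘ₗ p) = φ f := LinearMap.congr_fun hψ f
    rw [← h1, hy]
    rfl

theorem IsBiregular.embedsInFree (hU : IsBiregular A B U)
    (hB : IsCoherentModule B U) (hM : Module.FinitePresentation A M)
    (hT : IsTorsionless A U M) : EmbedsInFree A M := by
  have := hU.finitePresentation_dual hB hM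
  obtain ⟨s, hs⟩ := Module.Finite.fg_top (R := B) (M := M →ₗ[A] U)
  have : Module.Free A U := hU.nonempty_linearEquiv.elim fun e => .of_equiv e
  refine ⟨s → U, inferInstance, inferInstance, inferInstance,
    LinearMap.pi fun f => (f : M →ₗ[A] U), ?_⟩
  rw [← LinearMap.ker_eq_bot, LinearMap.ker_eq_bot']
  refine fun x hx => hT x fun φ => ?_
  -- Functionals vanishing at `x` form a `B`-submodule, so finitely many generators of `M*` already
  -- separate points.
  have hle : Submodule.span B (s : Set (M →ₗ[A] U)) ≤ LinearMap.ker (evalBidual A B U M x) :=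
    Submodule.span_le.mpr fun f hf => congrFun hx ⟨f, hf⟩
  exact hle (hs ▸ Submodule.mem_top)

end Dual

/-! ### FP-injectivity from torsionless cyclic modules -/

section Baer

variable {A B U : Type u} [Ring A] [Ring B] [AddCommGroup U] [Module A U] [Module B U]

theorem IsBiregular.isTorsionless_of_isCyclicModule (hU : IsBiregular A B U)
    (h : ∀ I : Submodule A U, I.FG → IsTorsionless A U (U ⧸ I)) {M : Type u} [AddCommGroup M]
    [Module A M] (hc : IsCyclicModule A M) (hM : Module.FinitePresentation A M) :
    IsTorsionless A U M := by
  obtain ⟨e⟩ := hU.nonempty_linearEquiv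
  have := hU.finitePresentation
  obtain ⟨x, hx⟩ := hc
  let p : U →ₗ[A] M := LinearMap.toSpanSingleton A M x ∘ₗ e.symm.toLinearMap
  have hp : Function.Surjective p := by
    refine Function.Surjective.comp (g := LinearMap.toSpanSingleton A M x) ?_ e.symm.surjective
    rw [← LinearMap.range_eq_top, LinearMap.range_toSpanSingleton, hx]
  exact (h _ (Module.FinitePresentation.fg_ker p hp)).of_injective
    (p.quotKerEquivOfSurjective hp).symm.toLinearMap (LinearEquiv.injective _)

theorem IsCyclicModule.of_surjective {M N : Type u} [AddCommGroup M] [Module A M] [AddCommGroup N]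
    [Module A N] (h : IsCyclicModule A M) (f : M →ₗ[A] N) (hf : Function.Surjective f) :
    IsCyclicModule A N := by
  obtain ⟨x, hx⟩ := h
  refine ⟨f x, ?_⟩
  rw [← Set.image_singleton, ← Submodule.map_span, hx, Submodule.map_top,
    LinearMap.range_eq_top.mpr hf]

theorem isTorsionless_quotient
    (h : ∀ (M : Type u) [AddCommGroup M] [Module A M], IsCyclicModule A M →
      Module.FinitePresentation A M → IsTorsionless A U M)
    {M : Type u} [AddCommGroup M] [Module A M] (hM : Module.FinitePresentation A M)
    (hc : IsCyclicModule A M) {N : Submodule A M} (hN : N.FG) : IsTorsionless A U (M ⧸ N) :=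
  h _ (hc.of_surjective N.mkQ N.mkQ_surjective)
    (Module.finitePresentation_of_surjective N.mkQ N.mkQ_surjective (by rwa [Submodule.ker_mkQ]))

variable [SMulCommClass A B U]

/-- The functionals on `U` vanishing on `I`. -/
def dualAnn (B : Type u) [Ring B] [Module B U] [SMulCommClass A B U] (I : Submodule A U) :
    Submodule B (U →ₗ[A] U) :=
  LinearMap.range (LinearMap.lcomp B U I.mkQ)

theorem mem_dualAnn {I : Submodule A U} {f : U →ₗ[A] U} :
    f ∈ dualAnn B I ↔ I ≤ LinearMap.ker f := by
  constructor
  · rintro ⟨g, rfl⟩ x hx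
    change g (I.mkQ x) = 0
    rw [Submodule.mkQ_apply, (Submodule.Quotient.mk_eq_zero I).mpr hx, map_zero]
  · exact fun h => ⟨I.liftQ f h, I.liftQ_mkQ f h⟩

theorem IsBiregular.fg_dualAnn (hU : IsBiregular A B U) (hB : IsCoherentModule B U)
    {I : Submodule A U} (hI : I.FG) : (dualAnn B I).FG := by
  have := hU.finitePresentation
  have := hU.finitePresentation_dual hB (M := U ⧸ I)
    (Module.finitePresentation_of_surjective I.mkQ I.mkQ_surjective (by rwa [Submodule.ker_mkQ]))
  exact Submodule.fg_range _

variable [SMulCommClass B A U]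

/-- On a cyclic submodule the map is the action of some `b : B`. On `N₁ + N₂`, the extensions from
the two summands are corrected to agree, since every functional vanishing on `N₁ ∩ N₂` is a sum of
one vanishing on `N₁` and one vanishing on `N₂`. -/
theorem IsBiregular.extendsFromFG (hU : IsBiregular A B U) (hB : IsCoherentModule B U)
    (hTA : ∀ (M : Type u) [AddCommGroup M] [Module A M], IsCyclicModule A M →
      Module.FinitePresentation A M → IsTorsionless A U M)
    (hTB : ∀ (M : Type u) [AddCommGroup M] [Module B M], IsCyclicModule B M →
      Module.FinitePresentation B M → IsTorsionless B U M) : ExtendsFromFG A U U := by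
  intro N hN
  induction N, hN using Submodule.fg_induction with
  | singleton x =>
    intro f
    set y : U := f ⟨x, Submodule.mem_span_singleton_self x⟩ with hy
    -- `U/Bx` is torsionless, and a functional killing `x` is the action of some `a` with `a • x =
    -- 0`; it kills `y = f x` as `f` is `A`-linear.
    have hmem : y ∈ Submodule.span B {x} := by
      refine isTorsionless_quotient_iff.mp (isTorsionless_quotient hTB hU.symm.finitePresentation hU.symm.isCyclicModule
        (Submodule.fg_span_singleton x)) _ fun φ hφ => ?_
      obtain ⟨u, hA, hB⟩ := hU
      obtain ⟨a, ha⟩ := hA.2 (φ u)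
      have hφa (z : U) : φ z = a • z := by
        obtain ⟨b, rfl⟩ := hB.2 z
        change φ (b • u) = a • b • u
        rw [map_smul, ← ha, smul_comm]
      have hax : a • x = 0 := by
        rw [← hφa]
        exact hφ (Submodule.mem_span_singleton_self x)
      have h0 : a • (⟨x, Submodule.mem_span_singleton_self x⟩ : Submodule.span A {x}) = 0 :=
        Subtype.ext hax
      rw [hφa, hy, ← map_smul, h0, map_zero]
    obtain ⟨b, hb⟩ := Submodule.mem_span_singleton.mp hmem
    refine ⟨b • LinearMap.id, fun z => ?_⟩
    obtain ⟨a, ha⟩ := Submodule.mem_span_singleton.mp z.2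
    have hz : z = a • (⟨x, Submodule.mem_span_singleton_self x⟩ : Submodule.span A {x}) :=
      Subtype.ext ha.symm
    rw [hz, map_smul, ← hy, ← hb]
    exact smul_comm b a x
  | sup N₁ N₂ hN₁ hN₂ ih₁ ih₂ =>
    intro f
    obtain ⟨g₁, hg₁⟩ := ih₁ (f ∘ₗ Submodule.inclusion le_sup_left)
    obtain ⟨g₂, hg₂⟩ := ih₂ (f ∘ₗ Submodule.inclusion le_sup_right)
    have hUA := hU.finitePresentation
    have hmem : g₁ - g₂ ∈ dualAnn B N₁ ⊔ dualAnn B N₂ := by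
      obtain ⟨u, hA, hB'⟩ := id hU
      have hcyc : IsCyclicModule B (U →ₗ[A] U) := by
        refine ⟨LinearMap.id, eq_top_iff.mpr fun f _ => ?_⟩
        obtain ⟨b, hb⟩ := hB'.2 (f u)
        refine Submodule.mem_span_singleton.mpr ⟨b, LinearMap.ext fun x => ?_⟩
        obtain ⟨a, rfl⟩ := hA.2 x
        change b • a • u = f (a • u)
        rw [map_smul, ← hb, smul_comm]
      refine isTorsionless_quotient_iff.mp (isTorsionless_quotient hTB
        (hU.finitePresentation_dual hB hUA) hcyc
        ((hU.fg_dualAnn hB hN₁).sup (hU.fg_dualAnn hB hN₂))) _ fun φ hφ => ?_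
      -- A functional on `U*` killing both annihilators is evaluation at a point of `N₁ ∩ N₂`, where
      -- `g₁` and `g₂` both equal `f`.
      obtain ⟨x, hx⟩ := hU.isReflexiveModule_self.exists_eq_eval φ
      have hx₁ : x ∈ N₁ := isTorsionless_quotient_iff.mp
        (isTorsionless_quotient hTA hUA hU.isCyclicModule hN₁) _ fun ψ hψ => by
          rw [← hx]
          exact hφ (Submodule.mem_sup_left (mem_dualAnn.mpr hψ))
      have hx₂ : x ∈ N₂ := isTorsionless_quotient_iff.mp
        (isTorsionless_quotient hTA hUA hU.isCyclicModule hN₂) _ fun ψ hψ => by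
          rw [← hx]
          exact hφ (Submodule.mem_sup_right (mem_dualAnn.mpr hψ))
      rw [hx, LinearMap.sub_apply, hg₁ ⟨x, hx₁⟩, hg₂ ⟨x, hx₂⟩, sub_eq_zero]
      rfl
    obtain ⟨p, hp, q, hq, hpq⟩ := Submodule.mem_sup.mp hmem
    rw [mem_dualAnn] at hp hq
    refine ⟨g₁ - p, fun x => ?_⟩
    obtain ⟨y, hy, z, hz, hyz⟩ := Submodule.mem_sup.mp x.2
    have hx : x = Submodule.inclusion le_sup_left ⟨y, hy⟩ +
        Submodule.inclusion le_sup_right ⟨z, hz⟩ := Subtype.ext hyz.symm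
    have h1 : g₁ - p = g₂ + q := by
      rw [sub_eq_iff_eq_add, add_assoc, add_comm q, hpq, add_sub_cancel]
    have hy' : (g₁ - p) y = g₁ y := by
      rw [LinearMap.sub_apply, LinearMap.mem_ker.mp (hp hy), sub_zero]
    have hz' : (g₁ - p) z = g₂ z := by
      rw [h1, LinearMap.add_apply, LinearMap.mem_ker.mp (hq hz), add_zero]
    rw [← hyz, map_add, hy', hz', hg₁ ⟨y, hy⟩, hg₂ ⟨z, hz⟩, hx, map_add]
    rfl

theorem IsBiregular.isFPInjective (hU : IsBiregular A B U) (hA : IsCoherentModule A U)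
    (hB : IsCoherentModule B U)
    (hTA : ∀ (M : Type u) [AddCommGroup M] [Module A M], IsCyclicModule A M →
      Module.FinitePresentation A M → IsTorsionless A U M)
    (hTB : ∀ (M : Type u) [AddCommGroup M] [Module B M], IsCyclicModule B M →
      Module.FinitePresentation B M → IsTorsionless B U M) : IsFPInjective A U := by
  obtain ⟨e⟩ := hU.nonempty_linearEquiv
  exact isFPInjective_of_extendsFromFG_pi fun n =>
    ((hU.extendsFromFG hB hTA hTB).pi hA n).of_linearEquiv
      (LinearEquiv.piCongrRight fun _ => e.symm)

end Baer

/-! ### Duality and reflexivity -/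

section FPDuality

variable {A B U : Type u} [Ring A] [Ring B] [AddCommGroup U] [Module A U] [Module B U]
  [SMulCommClass A B U] [SMulCommClass B A U]

theorem DeterminesFPDuality.symm (h : DeterminesFPDuality A B U) : DeterminesFPDuality B A U := by
  obtain ⟨hA, hB, h₁, h₂⟩ := h
  exact ⟨hB, hA, h₂, h₁⟩

theorem DeterminesFPDuality.isTorsionless (h : DeterminesFPDuality A B U)
    {M : Type u} [AddCommGroup M] [Module A M] (hM : Module.FinitePresentation A M) :
    IsTorsionless A U M := by
  obtain ⟨hA, hB, ⟨θ⟩, -⟩ := h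
  let X : (fpModules A).FullSubcategory := ⟨ModuleCat.of A M, hM⟩
  -- This isomorphism need not be evaluation: being isomorphic to any dual makes `M` torsionless.
  let e : M ≃ₗ[A] ((M →ₗ[A] U) →ₗ[B] U) := ((fpModules A).ι.mapIso (θ.app X)).toLinearEquiv
  exact (isTorsionless_dual (A := A) (M →ₗ[A] U)).of_injective e.toLinearMap e.injective

/-- The canonical isomorphism from the identity to the double dual on finitely presented modules,
when these are reflexive. -/
noncomputable def fpBidualIso (hA : DualPreservesFP A B U) (hB : DualPreservesFP B A U)
    (h : ∀ (M : Type u) [AddCommGroup M] [Module A M], Module.FinitePresentation A M →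
      IsReflexiveModule A B U M) :
    𝟭 _ ≅ (fpDualFunctor A B U hA).rightOp ⋙ fpDualFunctor B A U hB :=
  NatIso.ofComponents
    (fun M => (fpModules A).fullyFaithfulι.preimageIso
      (LinearEquiv.ofBijective (evalBidual A B U M.obj) (h M.obj M.property)).toModuleIso)
    (fun _ => rfl)

theorem determinesFPDuality_of_isReflexiveModule (hU : IsBiregular A B U)
    (cA : IsCoherentModule A U) (cB : IsCoherentModule B U)
    (hA : ∀ (M : Type u) [AddCommGroup M] [Module A M], Module.FinitePresentation A M →
      IsReflexiveModule A B U M)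
    (hB : ∀ (M : Type u) [AddCommGroup M] [Module B M], Module.FinitePresentation B M →
      IsReflexiveModule B A U M) : DeterminesFPDuality A B U :=
  ⟨fun _ hM => hU.finitePresentation_dual cB hM, fun _ hM => hU.symm.finitePresentation_dual cA hM,
    ⟨fpBidualIso _ _ hA⟩, ⟨fpBidualIso _ _ hB⟩⟩

end FPDuality

/-! ### Double annihilators -/

section Regular

variable {R : Type u} [Ring R]

theorem isBiregular_self : IsBiregular R Rᵐᵒᵖ R := by
  refine ⟨1, ?_, ?_⟩
  · simp only [smul_eq_mul, mul_one]
    exact Function.bijective_id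
  · simpa using MulOpposite.unop_bijective

theorem leftAnn_rightAnn_eq_iff (I : Submodule R R) :
    leftAnn (rightAnn (I : Set R) : Set R) = I ↔ IsTorsionless R R (R ⧸ I) := by
  rw [isTorsionless_quotient_iff]
  constructor
  · intro h x hx
    rw [← h]
    exact fun c hc => hx (LinearMap.toSpanSingleton R R c) fun y hy => hc y hy
  · refine fun h => le_antisymm (fun x hx => h x fun φ hφ => ?_) fun x hx c hc => hc x hx
    have hφ1 (y : R) : φ y = y * φ 1 := by rw [← smul_eq_mul, ← map_smul, smul_eq_mul, mul_one]
    rw [hφ1]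
    refine hx _ fun y hy => ?_
    rw [← hφ1]
    exact hφ hy

theorem rightAnn_leftAnn_eq_iff (J : Submodule Rᵐᵒᵖ R) :
    rightAnn (leftAnn (J : Set R) : Set R) = J ↔ IsTorsionless Rᵐᵒᵖ R (R ⧸ J) := by
  rw [isTorsionless_quotient_iff]
  constructor
  · intro h x hx
    rw [← h]
    exact fun c hc => hx (LinearMap.mulLeft Rᵐᵒᵖ c) fun y hy => hc y hy
  · refine fun h => le_antisymm (fun x hx => h x fun φ hφ => ?_) fun x hx c hc => hc x hx
    have hφ1 (y : R) : φ y = φ 1 * y := by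
      rw [← op_smul_eq_mul, ← map_smul, op_smul_eq_mul, one_mul]
    rw [hφ1]
    refine hx _ fun y hy => ?_
    rw [← hφ1]
    exact hφ hy

end Regular

end WeaklyQF

/-! ### The equivalences -/

open WeaklyQF in
theorem mainTheorem5 (R : Type u) [Ring R]
    (hleft : WeaklyQF.IsCoherentModule R R) (hright : WeaklyQF.IsCoherentModule Rᵐᵒᵖ R) :
    List.TFAE [
      WeaklyQF.IsWQF R,
      WeaklyQF.IsFPInjective R R ∧ WeaklyQF.IsFPInjective Rᵐᵒᵖ R,
      WeaklyQF.IsFPCogenerator R R ∧ WeaklyQF.IsFPCogenerator Rᵐᵒᵖ R,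
      WeaklyQF.IsFPInjective Rᵐᵒᵖ R ∧ WeaklyQF.IsFPCogenerator Rᵐᵒᵖ R,
      (∀ (M : Type u) [AddCommGroup M] [Module R M], Module.FinitePresentation R M →
          WeaklyQF.IsReflexiveModule R Rᵐᵒᵖ R M) ∧
        (∀ (M : Type u) [AddCommGroup M] [Module Rᵐᵒᵖ M], Module.FinitePresentation Rᵐᵒᵖ M →
          WeaklyQF.IsReflexiveModule Rᵐᵒᵖ R R M),
      (∀ (M : Type u) [AddCommGroup M] [Module R M], WeaklyQF.IsCyclicModule R M →
          Module.FinitePresentation R M → WeaklyQF.IsReflexiveModule R Rᵐᵒᵖ R M) ∧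
        (∀ (M : Type u) [AddCommGroup M] [Module Rᵐᵒᵖ M], WeaklyQF.IsCyclicModule Rᵐᵒᵖ M →
          Module.FinitePresentation Rᵐᵒᵖ M → WeaklyQF.IsReflexiveModule Rᵐᵒᵖ R R M),
      (∀ (M : Type u) [AddCommGroup M] [Module R M], WeaklyQF.IsCyclicModule R M →
          Module.FinitePresentation R M → WeaklyQF.EmbedsInFree R M) ∧
        (∀ (M : Type u) [AddCommGroup M] [Module Rᵐᵒᵖ M], WeaklyQF.IsCyclicModule Rᵐᵒᵖ M →
          Module.FinitePresentation Rᵐᵒᵖ M → WeaklyQF.EmbedsInFree Rᵐᵒᵖ M),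
      (∀ I : Submodule R R, I.FG →
          WeaklyQF.leftAnn (WeaklyQF.rightAnn (I : Set R) : Set R) = I) ∧
        (∀ J : Submodule Rᵐᵒᵖ R, J.FG →
          WeaklyQF.rightAnn (WeaklyQF.leftAnn (J : Set R) : Set R) = J)
    ] := by
  have hU : IsBiregular R Rᵐᵒᵖ R := isBiregular_self
  have ann_of_cyclic (h : (∀ (M : Type u) [AddCommGroup M] [Module R M], IsCyclicModule R M →
        Module.FinitePresentation R M → IsTorsionless R R M) ∧
      (∀ (M : Type u) [AddCommGroup M] [Module Rᵐᵒᵖ M], IsCyclicModule Rᵐᵒᵖ M →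
        Module.FinitePresentation Rᵐᵒᵖ M → IsTorsionless Rᵐᵒᵖ R M)) :
      (∀ I : Submodule R R, I.FG → leftAnn (rightAnn (I : Set R) : Set R) = I) ∧
        (∀ J : Submodule Rᵐᵒᵖ R, J.FG → rightAnn (leftAnn (J : Set R) : Set R) = J) :=
    ⟨fun I hI => (leftAnn_rightAnn_eq_iff I).mpr
      (isTorsionless_quotient h.1 hU.finitePresentation hU.isCyclicModule hI),
    fun J hJ => (rightAnn_leftAnn_eq_iff J).mpr
      (isTorsionless_quotient h.2 hU.symm.finitePresentation hU.symm.isCyclicModule hJ)⟩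
  tfae_have 8 → 2
  | ⟨h₁, h₂⟩ => by
    have t₁ : ∀ (M : Type u) [AddCommGroup M] [Module R M], IsCyclicModule R M →
        Module.FinitePresentation R M → IsTorsionless R R M := fun M _ _ hc hM =>
      hU.isTorsionless_of_isCyclicModule
        (fun I hI => (leftAnn_rightAnn_eq_iff I).mp (h₁ I hI)) hc hM
    have t₂ : ∀ (M : Type u) [AddCommGroup M] [Module Rᵐᵒᵖ M], IsCyclicModule Rᵐᵒᵖ M →
        Module.FinitePresentation Rᵐᵒᵖ M → IsTorsionless Rᵐᵒᵖ R M := fun M _ _ hc hM =>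
      hU.symm.isTorsionless_of_isCyclicModule
        (fun J hJ => (rightAnn_leftAnn_eq_iff J).mp (h₂ J hJ)) hc hM
    exact ⟨hU.isFPInjective hleft hright t₁ t₂, hU.symm.isFPInjective hright hleft t₂ t₁⟩
  tfae_have 2 → 5
  | ⟨h₁, h₂⟩ => ⟨fun M _ _ hM => hU.isReflexiveModule hright h₂ hM,
      fun M _ _ hM => hU.symm.isReflexiveModule hleft h₁ hM⟩
  tfae_have 5 → 1
  | ⟨h₁, h₂⟩ => determinesFPDuality_of_isReflexiveModule hU hleft hright h₁ h₂
  tfae_have 1 → 3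
  | h => ⟨isFPCogenerator_iff.mpr fun _ _ _ hM => h.isTorsionless hM,
      isFPCogenerator_iff.mpr fun _ _ _ hM => h.symm.isTorsionless hM⟩
  tfae_have 3 → 8
  | ⟨h₁, h₂⟩ => ann_of_cyclic ⟨fun M _ _ _ hM => isFPCogenerator_iff.mp h₁ M hM,
      fun M _ _ _ hM => isFPCogenerator_iff.mp h₂ M hM⟩
  -- FP-injectivity on the right makes finitely presented left modules reflexive, which supplies the
  -- missing left half.
  tfae_have 4 → 8
  | ⟨h₁, h₂⟩ => ann_of_cyclic
      ⟨fun M _ _ _ hM => isTorsionless_iff.mpr (hU.isReflexiveModule hright h₁ hM).1,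
      fun M _ _ _ hM => isFPCogenerator_iff.mp h₂ M hM⟩
  tfae_have 2 → 4
  | h => ⟨h.2, (tfae_1_to_3 (tfae_5_to_1 (tfae_2_to_5 h))).2⟩
  tfae_have 5 → 6
  | ⟨h₁, h₂⟩ => ⟨fun M _ _ _ hM => h₁ M hM, fun M _ _ _ hM => h₂ M hM⟩
  tfae_have 6 → 7
  | ⟨h₁, h₂⟩ => ⟨fun M _ _ hc hM =>
        hU.embedsInFree hright hM (isTorsionless_iff.mpr (h₁ M hc hM).1),
      fun M _ _ hc hM =>
        hU.symm.embedsInFree hleft hM (isTorsionless_iff.mpr (h₂ M hc hM).1)⟩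
  tfae_have 7 → 8
  | ⟨h₁, h₂⟩ => ann_of_cyclic
      ⟨fun M _ _ hc hM => hU.isTorsionless_of_embedsInFree (h₁ M hc hM),
      fun M _ _ hc hM => hU.symm.isTorsionless_of_embedsInFree (h₂ M hc hM)⟩
  tfae_finish
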